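/- **Lemma.** Let $n$ be the dimension, $\alpha=(\alpha_1,\alpha_2)\in\mathbb R^2$, $0<\theta\le q<\infty$, $\sigma_1=\theta\,(q/\theta)'$ (so $\sigma_1=\infty$ if $\theta=q$, where $r'$ is the conjugate exponent of $r$) and $q\le\sigma_2\le\infty$. *Weights.* A weight is a nonnegative locally integrable function on $\mathbb R^n$ with values in $(0,\infty)$ almost everywhere. For a set $A$ of finite positive measure put $M_{A,p}(f)=\big(\frac1{|A|}\int_A|f|^p\,dx\big)^{1/p}$ if $0<p<\infty$, and $M_{A,\infty}(f)=\operatorname{ess\,sup}_A|f|$. Let $\{t_k\}_{k\in\mathbb Z}$ belong to $\dot X_{\alpha,\sigma,q}$, $\sigma=(\sigma_1,\sigma_2)$; that is, each $t_k$ is a weight with $t_k\in L_q^{\rm loc}(\mathbb R^n)$, and there are $C_1,C_2>0$ such that for all integers $k\le j$ and all cubes $Q$ with sides parallel to the axes $$M_{Q,q}(t_k)\,M_{Q,\sigma_1}(t_j^{-1})\le C_1 2^{\alpha_1(k-j)},\qquad M_{Q,q}(t_k)^{-1}M_{Q,\sigma_2}(t_j)\le C_2 2^{\alpha_2(j-k)}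 .$$ *Sequences.* Let $Q_{k,m}=2^{-k}([0,1)^n+m)$ for $k\in\mathbb Z$, $m\in\mathbb Z^n$, and let $\chi_{k,m}$ be its indicator function. Let $\dot f_{\infty,q}(\mathbb R^n,\{t_k\})$ be the set of all complex sequences $\lambda=\{\lambda_{k,m}\}_{k\in\mathbb Z,m\in\mathbb Z^n}$ with $$\|\lambda\|:=\sup_{P}\Big(\frac1{|P|}\int_P\sum_{k\ge-\log_2 l(P)}\ \sum_{m\in\mathbb Z^n}2^{knq/2}\,t_k(x)^q\,|\lambda_{k,m}|^q\,\chi_{k,m}(x)\,dx\Big)^{1/q}<\infty ,$$ where $P$ runs over all dyadic cubes $Q_{j,h}$ and $l(P)$ is the side length of $P$, with the topology given by this quasi-norm. *Distributions.* Let $\mathcal S_\infty(\mathbb R^n)$ be the space of all $\varphi\in\mathcal S(\mathbb R^n)$ with $\int x^\beta\varphi(x)\,dx=0$ for all multi-indices $\beta$, with the topology induced by $\mathcal S(\mathbb R^n)$, and let $\mathcal S_\infty'(\mathbb R^n)$ be its topological dual with the strong topology (uniform convergence on bounded sets), in which a Schwartz function $g$ is identified with the functional $\varphi\mapsto\int g\varphi\,dx$.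 Let $\psi\in\mathcal S(\mathbb R^n)$, with $\mathcal F\psi(\xi)=(2\pi)^{-n/2}\int e^{-ix\cdot\xi}\psi(x)\,dx$, satisfy $\operatorname{supp}\mathcal F\psi\subset\{\frac12\le|\xi|\le2\}$ and, for some $c>0$, $|\mathcal F\psi(\xi)|\ge c$ if $\frac35\le|\xi|\le\frac53$. Put $\psi_{k,m}(x)=2^{kn/2}\psi(2^kx-m)$. Then for every $\lambda\in\dot f_{\infty,q}(\mathbb R^n,\{t_k\})$ the series $$T_\psi\lambda:=\sum_{k\in\mathbb Z}\sum_{m\in\mathbb Z^n}\lambda_{k,m}\psi_{k,m}$$ converges (unconditionally, as a series indexed by $(k,m)\in\mathbb Z\times\mathbb Z^n$) in $\mathcal S_\infty'(\mathbb R^n)$, and the map $T_\psi:\dot f_{\infty,q}(\mathbb R^n,\{t_k\})\to\mathcal S_\infty'(\mathbb R^n)$ is continuous. (Both assertions then hold for the weak-$*$ topology of $\mathcal S_\infty'(\mathbb R^n)$ as well.) -/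

import Mathlib

open MeasureTheory Topology
open scoped ENNReal SchwartzMap

noncomputable section

namespace WeightedTL

/-- The Euclidean space `ℝⁿ`. -/
abbrev E (n : ℕ) : Type := EuclideanSpace ℝ (Fin n)

variable {n : ℕ}

/-! ### Cubes, means and weights -/

/-- The half-open cube with sides parallel to the axes, lower corner `a` and side length `l`. -/
def cube (a : Fin n → ℝ) (l : ℝ) : Set (E n) :=
  {x | ∀ i, a i ≤ x i ∧ x i < a i + l}

/-- The dyadic cube `Q_{k,m} = 2^{-k} ([0,1)ⁿ + m)`. -/
def dyadicCube (k : ℤ) (m : Fin n → ℤ) : Set (E n) :=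
  cube (fun i => (2 : ℝ) ^ (-k) * (m i : ℝ)) ((2 : ℝ) ^ (-k))

/-- The mean `M_{A,p}(f) = (|A|⁻¹ ∫_A |f|^p)^{1/p}` for `0 < p < ∞`, and the essential supremum
of `|f|` over `A` for `p = ∞`: the `L_p` quasi-norm for the normalised Lebesgue measure on `A`. -/
def lpMean (A : Set (E n)) (p : ℝ≥0∞) (f : E n → ℝ) : ℝ≥0∞ :=
  eLpNorm f p ((volume A)⁻¹ • volume.restrict A)

/-- A weight: nonnegative, locally integrable, and with values in `(0, ∞)` almost everywhere. -/
structure IsWeight (t : E n → ℝ) : Prop where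
  nonneg : ∀ x, 0 ≤ t x
  locallyIntegrable : LocallyIntegrable t volume
  ae_pos : ∀ᵐ x, 0 < t x

/-- A `p`-admissible weight sequence: weights `t_k`, `k ∈ ℤ`, that lie in `L_p` on every
compact set. -/
structure IsAdmissible (p : ℝ≥0∞) (t : ℤ → E n → ℝ) : Prop where
  isWeight : ∀ k, IsWeight (t k)
  memLp : ∀ k, ∀ K : Set (E n), IsCompact K → MemLp (t k) p (volume.restrict K)

/-- The class `Ẋ_{α,σ,p}` of weight sequences. -/
structure InClassX (α₁ α₂ : ℝ) (σ₁ σ₂ p : ℝ≥0∞) (t : ℤ → E n → ℝ) : Prop where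
  isAdmissible : IsAdmissible p t
  bound₁ : ∃ C₁ : ℝ, 0 < C₁ ∧ ∀ k j : ℤ, k ≤ j → ∀ (a : Fin n → ℝ) (l : ℝ), 0 < l →
    lpMean (cube a l) p (t k) * lpMean (cube a l) σ₁ (fun x => (t j x)⁻¹)
      ≤ ENNReal.ofReal (C₁ * (2 : ℝ) ^ (α₁ * ((k : ℝ) - (j : ℝ))))
  bound₂ : ∃ C₂ : ℝ, 0 < C₂ ∧ ∀ k j : ℤ, k ≤ j → ∀ (a : Fin n → ℝ) (l : ℝ), 0 < l →
    (lpMean (cube a l) p (t k))⁻¹ * lpMean (cube a l) σ₂ (t j)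
      ≤ ENNReal.ofReal (C₂ * (2 : ℝ) ^ (α₂ * ((j : ℝ) - (k : ℝ))))

/-! ### The sequence space `ḟ_{∞,q}` -/

/-- The quasi-norm of `ḟ_{∞,q}(ℝⁿ, {t_k})`; here `P = Q_{j,h}` runs over all dyadic cubes, so that
`-log₂ l(P) = j`. -/
def fInftyNorm (q : ℝ) (t : ℤ → E n → ℝ) (lam : ℤ → (Fin n → ℤ) → ℂ) : ℝ≥0∞ :=
  ⨆ (j : ℤ) (h : Fin n → ℤ),
    ((volume (dyadicCube j h))⁻¹ * ∫⁻ x in dyadicCube j h,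
      ∑' k : {k : ℤ // j ≤ k}, ∑' m : Fin n → ℤ,
        (dyadicCube (k : ℤ) m).indicator
          (fun y => (2 : ℝ≥0∞) ^ (((k : ℤ) : ℝ) * (n : ℝ) * q / 2) *
            ‖t (k : ℤ) y‖ₑ ^ q * ‖lam (k : ℤ) m‖ₑ ^ q) x) ^ (1 / q)

/-- The space `ḟ_{∞,q}(ℝⁿ, {t_k})` of all sequences with finite quasi-norm. -/
def FInfty (q : ℝ) (t : ℤ → E n → ℝ) : Type :=
  {lam : ℤ → (Fin n → ℤ) → ℂ // fInftyNorm q t lam < ∞}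

/-- The topology given by the quasi-norm: a set is open when it contains, with each of its points
`lam`, a quasi-norm ball `{mu | ‖mu - lam‖ < ε}`. -/
instance (q : ℝ) (t : ℤ → E n → ℝ) : TopologicalSpace (FInfty q t) where
  IsOpen U := ∀ lam ∈ U, ∃ ε : ℝ≥0∞, 0 < ε ∧
    ∀ mu : FInfty q t, fInftyNorm q t (mu.1 - lam.1) < ε → mu ∈ U
  isOpen_univ := fun _ _ => ⟨1, one_pos, fun _ _ => trivial⟩
  isOpen_inter := by
    intro U V hU hV lam hlam
    obtain ⟨ε, hε, h⟩ := hU lam hlam.1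
    obtain ⟨δ, hδ, h'⟩ := hV lam hlam.2
    exact ⟨min ε δ, lt_min hε hδ, fun mu hmu =>
      ⟨h mu (hmu.trans_le (min_le_left _ _)), h' mu (hmu.trans_le (min_le_right _ _))⟩⟩
  isOpen_sUnion := by
    intro S hS lam hlam
    obtain ⟨U, hUS, hU⟩ := hlam
    obtain ⟨ε, hε, h⟩ := hS U hUS lam hU
    exact ⟨ε, hε, fun mu hmu => ⟨U, hUS, h mu hmu⟩⟩

/-! ### The space `𝓢_∞` and its dual -/

/-- The monomial `x^β`. -/
def monomial (β : Fin n → ℕ) (x : E n) : ℂ := ∏ i, ((x i : ℝ) : ℂ) ^ β i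

theorem monomial_hasTemperateGrowth (β : Fin n → ℕ) :
    Function.HasTemperateGrowth (monomial β) := by
  have h (i : Fin n) : Function.HasTemperateGrowth (fun x : E n => ((x i : ℝ) : ℂ)) :=
    (Complex.ofRealCLM.comp (EuclideanSpace.proj i : E n →L[ℝ] ℝ)).hasTemperateGrowth
  have hp (i : Fin n) (b : ℕ) :
      Function.HasTemperateGrowth (fun x : E n => ((x i : ℝ) : ℂ) ^ b) := by
    induction b with
    | zero => simp only [pow_zero]; exact Function.HasTemperateGrowth.const (1 : ℂ)
    | succ b ih => simp only [pow_succ]; exact ih.mul (h i)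
  have hs (s : Finset (Fin n)) :
      Function.HasTemperateGrowth (fun x : E n => ∏ i ∈ s, ((x i : ℝ) : ℂ) ^ β i) := by
    classical
    induction s using Finset.induction_on with
    | empty => simp only [Finset.prod_empty]; exact Function.HasTemperateGrowth.const (1 : ℂ)
    | insert a s ha ih => simp only [Finset.prod_insert ha]; exact (hp a (β a)).mul ih
  exact hs Finset.univ

theorem integrable_monomial_mul (β : Fin n → ℕ) (φ : 𝓢(E n, ℂ)) :
    Integrable (fun x => monomial β x * φ x) := by
  have h := (SchwartzMap.smulLeftCLM ℂ (monomial β) φ).integrable (μ := volume)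
  rwa [SchwartzMap.smulLeftCLM_apply (monomial_hasTemperateGrowth β)] at h

/-- The space `𝓢_∞(ℝⁿ)` of the Schwartz functions all of whose moments vanish, with the topology
induced by `𝓢(ℝⁿ)`. -/
def SInfty (n : ℕ) : Submodule ℂ 𝓢(E n, ℂ) where
  carrier := {φ | ∀ β : Fin n → ℕ, ∫ x, monomial β x * φ x = 0}
  zero_mem' := by intro β; simp
  add_mem' := by
    intro φ χ hφ hχ β
    simp only [add_apply, mul_add]
    rw [integral_add (integrable_monomial_mul β φ) (integrable_monomial_mul β χ), hφ β, hχ β,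
      add_zero]
  smul_mem' := by
    intro c φ hφ β
    simp only [smul_apply, smul_eq_mul, mul_left_comm _ c]
    rw [integral_const_mul, hφ β, mul_zero]

/-- The topological dual `𝓢_∞'(ℝⁿ)`, with the strong topology, that is, the topology of uniform
convergence on the bounded subsets of `𝓢_∞(ℝⁿ)`. -/
abbrev SInftyDual (n : ℕ) : Type := SInfty n →L[ℂ] ℂ

/-- A Schwartz function `g` as the element `φ ↦ ∫ g φ` of `𝓢_∞'(ℝⁿ)`. -/
def toSInftyDual (g : 𝓢(E n, ℂ)) : SInftyDual n :=
  (SchwartzMap.integralCLM ℂ (volume : Measure (E n))).comp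
    ((SchwartzMap.pairing (ContinuousLinearMap.mul ℂ ℂ) g).comp (SInfty n).subtypeL)

theorem toSInftyDual_apply (g : 𝓢(E n, ℂ)) (φ : SInfty n) :
    toSInftyDual g φ = ∫ x, g x * (φ : 𝓢(E n, ℂ)) x := by
  simp [toSInftyDual]

/-! ### The inverse `φ`-transform -/

/-- The Fourier transform `𝓕ψ(ξ) = (2π)^{-n/2} ∫ e^{-i x·ξ} ψ(x) dx`. -/
def fourier (ψ : 𝓢(E n, ℂ)) (ξ : E n) : ℂ :=
  (((2 * Real.pi) ^ (-((n : ℝ) / 2)) : ℝ) : ℂ) *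
    ∫ x : E n, Complex.exp (-(Complex.I * ((inner ℝ x ξ : ℝ) : ℂ))) * ψ x

/-- The dilated and translated function `ψ_{k,m}(x) = 2^{kn/2} ψ(2^k x - m)`. -/
def wavelet (ψ : 𝓢(E n, ℂ)) (k : ℤ) (m : Fin n → ℤ) : 𝓢(E n, ℂ) :=
  (((2 : ℝ) ^ ((k : ℝ) * (n : ℝ) / 2) : ℝ) : ℂ) •
    SchwartzMap.compCLMOfContinuousLinearEquiv ℂ
      (ContinuousLinearEquiv.smulLeft (Units.mk0 ((2 : ℝ) ^ k) (by positivity)))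
      (SchwartzMap.compSubConstCLM ℂ (WithLp.toLp 2 (fun i => (m i : ℝ)) : E n) ψ)

theorem wavelet_apply (ψ : 𝓢(E n, ℂ)) (k : ℤ) (m : Fin n → ℤ) (x : E n) :
    wavelet ψ k m x = (((2 : ℝ) ^ ((k : ℝ) * (n : ℝ) / 2) : ℝ) : ℂ) *
      ψ ((2 : ℝ) ^ k • x - WithLp.toLp 2 (fun i => (m i : ℝ))) := rfl

/-- The general term `λ_{k,m} ψ_{k,m}`, as an element of `𝓢_∞'(ℝⁿ)`. -/
def seriesTerm (ψ : 𝓢(E n, ℂ)) (lam : ℤ → (Fin n → ℤ) → ℂ) (p : ℤ × (Fin n → ℤ)) : SInftyDual n :=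
  lam p.1 p.2 • toSInftyDual (wavelet ψ p.1 p.2)

/-- The inverse `φ`-transform `T_ψ λ = ∑_{k,m} λ_{k,m} ψ_{k,m}`, the sum being taken in the
topological space `𝓢_∞'(ℝⁿ)`. -/
def Tψ {q : ℝ} {t : ℤ → E n → ℝ} (ψ : 𝓢(E n, ℂ)) (lam : FInfty q t) : SInftyDual n :=
  ∑' p : ℤ × (Fin n → ℤ), seriesTerm ψ lam.1 p

end WeightedTL

end

noncomputable section

namespace WeightedTL

variable {n : ℕ}

/-! The coefficients of a sequence with finite quasi-norm grow at most polynomially, while the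
pairings of wavelets with test functions decay faster than any polynomial.

Growth (`InClassX.exists_enorm_le_fInftyNorm`): testing the quasi-norm on `P = Q_{k,m}` bounds
`2^{kn/2} |λ_{k,m}| M_{Q,q}(t_k)`. Since `1/q + 1/σ₁ = 1/θ`, Hölder bounds `M_{Q,q}(t_k)` below by
the reciprocal of `M_{Q,σ₁}(t_k⁻¹)`. Passing to a cube that contains both `Q_{k,m}` and the unit
cube, the class conditions compare `t_k⁻¹` with the fixed weight `t_0`. The result is `|λ_{k,m}| ≤ C
2^{A|k|} (1+|m|)^B ‖λ‖`.

Decay (`norm_toSInftyDual_wavelet_le`): both `ψ` and the test function have vanishing moments, so a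
Taylor polynomial can be subtracted from whichever factor varies more slowly.

Each term is therefore at most `‖λ‖ w_{k,m} P(φ)`, with `w` summable and `P` a continuous seminorm.
As `P` is bounded on bounded sets, this gives unconditional convergence in the strong dual; applied
to differences, it gives continuity. -/

/-! ### Taylor expansion against vanishing moments -/

open scoped Nat in
/-- Taylor's theorem along a segment. -/
theorem norm_sub_sum_iteratedFDeriv_le {V F : Type*} [NormedAddCommGroup V] [NormedSpace ℝ V]
    [NormedAddCommGroup F] [NormedSpace ℝ F] {f : V → F} {N : ℕ} (hf : ContDiff ℝ (N + 1) f)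
    (a v : V) {C : ℝ}
    (hC : ∀ s ∈ Set.Icc (0 : ℝ) 1, ‖iteratedFDeriv ℝ (N + 1) f (a + s • v)‖ ≤ C) :
    ‖f (a + v) - ∑ k ∈ Finset.range (N + 1),
      (k ! : ℝ)⁻¹ • iteratedFDeriv ℝ k f a (fun _ => v)‖ ≤ C * ‖v‖ ^ (N + 1) := by
  set h : ℝ → F := fun s => f (a + s • v) with hh
  set l : ℝ →L[ℝ] V := (ContinuousLinearMap.id ℝ ℝ).smulRight v with hl
  have hlv (s : ℝ) : l s = s • v := by simp [hl]
  have hcd : ContDiff ℝ (N + 1) (fun z => f (a + z)) := hf.comp (contDiff_const.add contDiff_id)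
  have hh' : h = (fun z => f (a + z)) ∘ l := by ext s; simp [hh, hlv]
  have hhc : ContDiff ℝ (N + 1) h := by rw [hh']; exact hcd.comp l.contDiff
  -- On the segment everything reduces to one variable: the derivatives of `h` are the Fréchet
  -- derivatives of `f` on the diagonal `(v, …, v)`.
  have hder (k : ℕ) (hk : k ≤ N + 1) (s : ℝ) (hs : s ∈ Set.Icc (0 : ℝ) 1) :
      iteratedDerivWithin k h (Set.Icc 0 1) s = iteratedFDeriv ℝ k f (a + s • v) (fun _ => v) := by
    have hk' : (k : WithTop ℕ∞) ≤ N + 1 := by exact_mod_cast hk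
    rw [iteratedDerivWithin_eq_iteratedDeriv (uniqueDiffOn_Icc zero_lt_one)
      (hhc.of_le hk').contDiffAt hs, iteratedDeriv_eq_iteratedFDeriv, hh',
      l.iteratedFDeriv_comp_right hcd s hk', iteratedFDeriv_comp_add_left, hlv]
    simp [hlv]
  have hbound : ∀ y ∈ Set.Icc (0 : ℝ) 1,
      ‖iteratedDerivWithin (N + 1) h (Set.Icc 0 1) y‖ ≤ C * ‖v‖ ^ (N + 1) := by
    intro y hy
    rw [hder _ le_rfl y hy]
    refine (ContinuousMultilinearMap.le_opNorm _ _).trans ?_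
    simpa using mul_le_mul_of_nonneg_right (hC y hy) (by positivity : 0 ≤ ‖v‖ ^ (N + 1))
  have hC0 : 0 ≤ C := (norm_nonneg _).trans (hC 0 (by simp))
  have key := taylor_mean_remainder_bound (x := 1) zero_le_one hhc.contDiffOn
    (by simp) hbound
  rw [taylor_within_apply] at key
  have hsum : ∑ k ∈ Finset.range (N + 1), ((k ! : ℝ)⁻¹ * (1 - 0) ^ k) •
      iteratedDerivWithin k h (Set.Icc 0 1) 0 = ∑ k ∈ Finset.range (N + 1),
      (k ! : ℝ)⁻¹ • iteratedFDeriv ℝ k f a (fun _ => v) := by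
    refine Finset.sum_congr rfl fun k hk => ?_
    rw [hder k (Finset.mem_range.1 hk).le 0 (by simp)]
    simp
  rw [hsum] at key
  simp only [hh, one_smul, sub_zero, one_pow, mul_one] at key
  exact key.trans (div_le_self (by positivity) (by exact_mod_cast Nat.succ_le_of_lt N.factorial_pos))

/-- A homogeneous polynomial as a linear combination of monomials. -/
theorem apply_diag_eq_sum_monomial {k : ℕ} (L : ContinuousMultilinearMap ℝ (fun _ : Fin k => E n) ℂ)
    (x : E n) : L (fun _ => x) = ∑ r : Fin k → Fin n,
      L (fun j => EuclideanSpace.single (r j) 1) *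
        monomial (fun i => (Finset.univ.filter fun j => r j = i).card) x := by
  have hx : x = ∑ i, x i • EuclideanSpace.single i (1 : ℝ) := by
    ext j
    simp [Finset.sum_apply, Pi.single_apply]
  conv_lhs => rw [hx, L.map_sum (fun _ i => x i • EuclideanSpace.single i (1 : ℝ))]
  refine Finset.sum_congr rfl fun r _ => ?_
  rw [L.map_smul_univ (fun j => x (r j)), monomial, mul_comm, Complex.real_smul]
  congr 1
  push_cast
  -- Grouping the factors `x (r j)` by the value of `r j` turns the product into a monomial whose
  -- exponents are the fibre sizes.
  rw [← Finset.prod_fiberwise' (s := Finset.univ) (g := r)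
    (f := fun i => ((x i : ℝ) : ℂ))]
  simp

theorem integrable_apply_diag_mul {k : ℕ}
    (L : ContinuousMultilinearMap ℝ (fun _ : Fin k => E n) ℂ) (g : 𝓢(E n, ℂ)) :
    Integrable (fun x => L (fun _ => x) * g x) := by
  simp_rw [apply_diag_eq_sum_monomial, Finset.sum_mul, mul_assoc]
  exact integrable_finsetSum _ fun r _ => (integrable_monomial_mul _ g).const_mul _

theorem integral_apply_diag_mul_eq_zero {k : ℕ}
    (L : ContinuousMultilinearMap ℝ (fun _ : Fin k => E n) ℂ) (g : SInfty n) :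
    ∫ x, L (fun _ => x) * (g : 𝓢(E n, ℂ)) x = 0 := by
  simp_rw [apply_diag_eq_sum_monomial, Finset.sum_mul, mul_assoc]
  rw [integral_finsetSum _ fun r _ => (integrable_monomial_mul _ _).const_mul _]
  refine Finset.sum_eq_zero fun r _ => ?_
  rw [integral_const_mul, g.2, mul_zero]

/-- The supremum of the Schwartz seminorms of order up to `L` with weight up to `L`. -/
def schwartzSup (n L : ℕ) : Seminorm ℂ 𝓢(E n, ℂ) :=
  (Finset.Iic (L, L)).sup (schwartzSeminormFamily ℂ (E n) ℂ)

theorem one_add_pow_mul_norm_iteratedFDeriv_le {k m L : ℕ} (hk : k ≤ L) (hm : m ≤ L)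
    (f : 𝓢(E n, ℂ)) (x : E n) :
    (1 + ‖x‖) ^ k * ‖iteratedFDeriv ℝ m f x‖ ≤ 2 ^ L * schwartzSup n L f :=
  SchwartzMap.one_add_le_sup_seminorm_apply (𝕜 := ℂ) (m := (L, L)) hk hm f x

/-- Pairing a dilated and translated Schwartz function with one with vanishing moments. -/
theorem norm_integral_comp_affine_mul_le (n N M : ℕ) :
    ∃ C : ℝ, 0 ≤ C ∧ ∃ L : ℕ, ∀ (f : 𝓢(E n, ℂ)) (g : SInfty n) (ε : ℝ), 0 < ε → ε ≤ 1 →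
      ∀ a : E n, ‖∫ x, f (a + ε • x) * (g : 𝓢(E n, ℂ)) x‖ ≤
        C * ε ^ (N + 1) * ((1 + ‖a‖) ^ M)⁻¹ * (schwartzSup n L f * schwartzSup n L g) := by
  -- Powers of `1 + ‖x‖` that `g` must absorb: `N + 1` from the Taylor remainder, `M` from moving
  -- the decay of `f` to the point `a`, and `n + 1` for integrability.
  set L := N + 1 + M + n + 1 with hL
  set J : ℝ := ∫ x : E n, ((1 + ‖x‖) ^ (n + 1))⁻¹ with hJ
  have hJint : Integrable (fun x : E n => ((1 + ‖x‖) ^ (n + 1))⁻¹) := by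
    have := integrable_one_add_norm (E := E n) (μ := volume) (r := (n + 1 : ℕ)) (by simp)
    refine this.congr (.of_forall fun x => ?_)
    simp only [Real.rpow_neg (by positivity : (0 : ℝ) ≤ 1 + ‖x‖), Real.rpow_natCast]
  refine ⟨2 ^ L * 2 ^ L * J, by positivity, L, fun f g ε hε hε1 a => ?_⟩
  set A := schwartzSup n L f
  set B := schwartzSup n L (g : 𝓢(E n, ℂ))
  have hA : 0 ≤ A := apply_nonneg _ _
  have hB : 0 ≤ B := apply_nonneg _ _
  set T : E n → ℂ := fun x => ∑ k ∈ Finset.range (N + 1),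
      (k.factorial : ℝ)⁻¹ • iteratedFDeriv ℝ k f a (fun _ => ε • x) with hT
  have hTterm (k : ℕ) (x : E n) : ((k.factorial : ℝ)⁻¹ • iteratedFDeriv ℝ k f a (fun _ => ε • x))
      * (g : 𝓢(E n, ℂ)) x = (((k.factorial : ℝ)⁻¹ * ε ^ k) • iteratedFDeriv ℝ k f a) (fun _ => x)
      * (g : 𝓢(E n, ℂ)) x := by
    rw [ContinuousMultilinearMap.map_smul_univ _ (fun _ => ε) (fun _ => x)]
    simp [mul_assoc]
  have hTint : Integrable (fun x => T x * (g : 𝓢(E n, ℂ)) x) := by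
    simp only [hT, Finset.sum_mul, hTterm]
    exact integrable_finsetSum _ fun k _ => integrable_apply_diag_mul _ _
  -- The Taylor polynomial is a polynomial in `x`, so the moments of `g` annihilate it and only the
  -- remainder, of order `ε ^ (N + 1)`, survives.
  have hTzero : ∫ x, T x * (g : 𝓢(E n, ℂ)) x = 0 := by
    simp only [hT, Finset.sum_mul, hTterm]
    rw [integral_finsetSum _ fun k _ => integrable_apply_diag_mul _ _]
    exact Finset.sum_eq_zero fun k _ => integral_apply_diag_mul_eq_zero _ _
  have hfint : Integrable (fun x => f (a + ε • x) * (g : 𝓢(E n, ℂ)) x) := by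
    refine (g : 𝓢(E n, ℂ)).integrable.bdd_mul (c := 2 ^ L * A) ?_ (.of_forall fun x => ?_)
    · exact (f.continuous.comp (by fun_prop)).aestronglyMeasurable
    · simpa using one_add_pow_mul_norm_iteratedFDeriv_le (k := 0) (m := 0) (L := L)
        (by omega) (by omega) f (a + ε • x)
  have heq : ∫ x, f (a + ε • x) * (g : 𝓢(E n, ℂ)) x =
      ∫ x, (f (a + ε • x) - T x) * (g : 𝓢(E n, ℂ)) x := by
    simp_rw [sub_mul]
    rw [integral_sub hfint hTint, hTzero, sub_zero]
  have hpt (x : E n) : ‖(f (a + ε • x) - T x) * (g : 𝓢(E n, ℂ)) x‖ ≤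
      2 ^ L * 2 ^ L * ε ^ (N + 1) * ((1 + ‖a‖) ^ M)⁻¹ * (A * B) * ((1 + ‖x‖) ^ (n + 1))⁻¹ := by
    have h1 : ‖f (a + ε • x) - T x‖ ≤
        (2 ^ L * A * ((1 + ‖x‖) ^ M * ((1 + ‖a‖) ^ M)⁻¹)) * ‖ε • x‖ ^ (N + 1) := by
      refine norm_sub_sum_iteratedFDeriv_le (f.smooth (N + 1)) a (ε • x) fun s hs => ?_
      have h2 := one_add_pow_mul_norm_iteratedFDeriv_le (k := M) (m := N + 1) (L := L)
        (by omega) (by omega) f (a + s • ε • x)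
      -- Peetre's inequality; it is uniform in `s` and `ε` because `s * ε ≤ 1`.
      have h3 : 1 + ‖a‖ ≤ (1 + ‖a + s • ε • x‖) * (1 + ‖x‖) := by
        have h4 : ‖a‖ ≤ ‖a + s • ε • x‖ + ‖s • ε • x‖ := by
          simpa using norm_sub_le (a + s • ε • x) (s • ε • x)
        have h5 : ‖s • ε • x‖ ≤ ‖x‖ := by
          rw [norm_smul, norm_smul, Real.norm_of_nonneg hs.1, Real.norm_of_nonneg hε.le, ← mul_assoc]
          exact mul_le_of_le_one_left (norm_nonneg _) (mul_le_one₀ hs.2 hε.le hε1)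
        nlinarith [norm_nonneg x, norm_nonneg (a + s • ε • x)]
      have h6 : (1 + ‖a‖) ^ M ≤ (1 + ‖a + s • ε • x‖) ^ M * (1 + ‖x‖) ^ M := by
        rw [← mul_pow]; gcongr
      rw [← mul_assoc, ← div_eq_mul_inv, le_div_iff₀ (by positivity)]
      calc _ ≤ ‖iteratedFDeriv ℝ (N + 1) f (a + s • ε • x)‖ *
            ((1 + ‖a + s • ε • x‖) ^ M * (1 + ‖x‖) ^ M) := by gcongr
        _ = ((1 + ‖a + s • ε • x‖) ^ M * ‖iteratedFDeriv ℝ (N + 1) f (a + s • ε • x)‖) *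
            (1 + ‖x‖) ^ M := by ring
        _ ≤ _ := by gcongr
    have h7 := one_add_pow_mul_norm_iteratedFDeriv_le (k := L) (m := 0) (L := L)
        le_rfl (by omega) (g : 𝓢(E n, ℂ)) x
    rw [norm_iteratedFDeriv_zero] at h7
    rw [norm_mul, ← div_eq_mul_inv _ ((1 + ‖x‖) ^ (n + 1)), le_div_iff₀ (by positivity)]
    rw [norm_smul, Real.norm_of_nonneg hε.le, mul_pow] at h1
    have h8 : ‖x‖ ^ (N + 1) ≤ (1 + ‖x‖) ^ (N + 1) := by gcongr; linarith
    calc ‖f (a + ε • x) - T x‖ * ‖(g : 𝓢(E n, ℂ)) x‖ * (1 + ‖x‖) ^ (n + 1)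
        ≤ ((2 ^ L * A * ((1 + ‖x‖) ^ M * ((1 + ‖a‖) ^ M)⁻¹)) * (ε ^ (N + 1) * (1 + ‖x‖) ^ (N + 1)))
          * ‖(g : 𝓢(E n, ℂ)) x‖ * (1 + ‖x‖) ^ (n + 1) := by
          gcongr
          exact h1.trans (by gcongr)
      _ = (2 ^ L * A * ε ^ (N + 1) * ((1 + ‖a‖) ^ M)⁻¹) *
          ((1 + ‖x‖) ^ L * ‖(g : 𝓢(E n, ℂ)) x‖) := by rw [hL]; ring
      _ ≤ (2 ^ L * A * ε ^ (N + 1) * ((1 + ‖a‖) ^ M)⁻¹) * (2 ^ L * B) := by gcongr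
      _ = _ := by ring
  rw [heq]
  refine (norm_integral_le_of_norm_le (hJint.const_mul _) (.of_forall hpt)).trans_eq ?_
  rw [integral_const_mul]
  ring

/-! ### Vanishing moments from the Fourier support -/

open scoped FourierTransform LineDeriv in
/-- Multiplication by these functions preserves the Schwartz functions whose Fourier transform
vanishes near the origin. -/
def fourierLocalMultiplier (n : ℕ) (r : ℝ) : Submonoid (E n → ℂ) where
  carrier := {p | ∀ f : 𝓢(E n, ℂ), (∀ ξ ∈ Metric.ball (0 : E n) r, (𝓕 f : 𝓢(E n, ℂ)) ξ = 0) →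
    ∃ h : 𝓢(E n, ℂ), (∀ ξ ∈ Metric.ball (0 : E n) r, (𝓕 h : 𝓢(E n, ℂ)) ξ = 0) ∧ ∀ x, h x = p x * f x}
  one_mem' := fun f hf => ⟨f, hf, by simp⟩
  mul_mem' := by
    intro p p' hp hp' f hf
    obtain ⟨h, hh, he⟩ := hp' f hf
    obtain ⟨h', hh', he'⟩ := hp h hh
    exact ⟨h', hh', fun x => by simp [he, he', mul_assoc]⟩

open scoped FourierTransform LineDeriv in
-- Multiplication by a coordinate becomes, up to a nonzero constant, a partial derivative of the
-- Fourier transform, and a derivative vanishes on any open set where the function does.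
theorem coord_mem_fourierLocalMultiplier (r : ℝ) (i : Fin n) :
    (fun x : E n => ((x i : ℝ) : ℂ)) ∈ fourierLocalMultiplier n r := by
  intro f hf
  set e : E n := EuclideanSpace.single i (1 : ℝ)
  have ht : Function.HasTemperateGrowth (fun x : E n => inner ℝ x e) :=
    ((innerSL ℝ).flip e).hasTemperateGrowth
  refine ⟨SchwartzMap.smulLeftCLM ℂ (fun x : E n => inner ℝ x e) f, fun ξ hξ => ?_, fun x => ?_⟩
  · have h1 := SchwartzMap.lineDerivOp_fourier_eq f e
    have h2 : (∂_{e} (𝓕 f)) ξ = 0 := by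
      rw [SchwartzMap.lineDerivOp_apply_eq_fderiv]
      have : (𝓕 f : 𝓢(E n, ℂ)) =ᶠ[𝓝 ξ] (fun _ => (0 : ℂ)) := by
        filter_upwards [Metric.isOpen_ball.mem_nhds hξ] with y hy using hf y hy
      rw [this.fderiv_eq]
      simp
    rw [h1, FourierTransform.fourier_smul] at h2
    simpa [Real.pi_ne_zero] using h2
  · rw [SchwartzMap.smulLeftCLM_apply_apply ht]
    simp [e, EuclideanSpace.inner_single_right]

open scoped FourierTransform in
-- The moment of order `β` is the Fourier transform of `x^β f` at the origin, and monomials are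
-- products of coordinates.
theorem mem_SInfty_of_fourier_eq_zero {f : 𝓢(E n, ℂ)} {r : ℝ} (hr : 0 < r)
    (hf : ∀ ξ ∈ Metric.ball (0 : E n) r, (𝓕 f : 𝓢(E n, ℂ)) ξ = 0) : f ∈ SInfty n := by
  intro β
  have hβ : monomial β ∈ fourierLocalMultiplier n r := by
    have : monomial β = ∏ i, (fun x : E n => ((x i : ℝ) : ℂ)) ^ β i := by
      ext x; simp [monomial, Finset.prod_apply]
    rw [this]
    exact Submonoid.prod_mem _ fun i _ =>
      Submonoid.pow_mem _ (coord_mem_fourierLocalMultiplier r i) _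
  obtain ⟨h, hh, he⟩ := hβ f hf
  have h0 := hh 0 (by simpa using hr)
  rw [SchwartzMap.fourier_coe, Real.fourier_eq] at h0
  simpa [he] using h0

open scoped FourierTransform in
theorem mem_SInfty_of_tsupport_fourier {ψ : 𝓢(E n, ℂ)}
    (hψ : tsupport (fourier ψ) ⊆ {ξ | 1 / 2 ≤ ‖ξ‖ ∧ ‖ξ‖ ≤ 2}) : ψ ∈ SInfty n := by
  -- The transform `𝓕` has the phase `2π x·ξ`, so its value at `ξ` corresponds to `fourier ψ` at
  -- `2πξ`; the radius `1/2` becomes `1/(4π)`.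
  refine mem_SInfty_of_fourier_eq_zero (r := 1 / (4 * Real.pi)) (by positivity) fun ξ hξ => ?_
  have h1 : fourier ψ ((2 * Real.pi) • ξ) = 0 := by
    refine image_eq_zero_of_notMem_tsupport fun hmem => ?_
    have h2 := (hψ hmem).1
    rw [norm_smul, Real.norm_of_nonneg (by positivity)] at h2
    rw [mem_ball_zero_iff, lt_div_iff₀ (by positivity)] at hξ
    linarith
  have hc : (((2 * Real.pi) ^ (-((n : ℝ) / 2)) : ℝ) : ℂ) ≠ 0 := by
    exact_mod_cast (Real.rpow_pos_of_pos (by positivity) _).ne'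
  rw [fourier, mul_eq_zero, or_iff_right hc] at h1
  rw [SchwartzMap.fourier_coe, Real.fourier_eq', ← h1]
  refine integral_congr_ae (.of_forall fun x => ?_)
  simp only [smul_eq_mul]
  congr 2
  rw [inner_smul_right]
  push_cast
  ring

/-! ### Decay of the wavelet pairings -/

/-- An integer vector as a point of `ℝⁿ`. -/
def latticePoint (m : Fin n → ℤ) : E n := WithLp.toLp 2 (fun i => (m i : ℝ))

theorem integral_comp_smul_sub_mul (ψ φ : 𝓢(E n, ℂ)) {ε : ℝ} (hε : 0 < ε) (b : E n) :
    ∫ x, ψ (ε⁻¹ • x - b) * φ x = ((ε ^ n : ℝ) : ℂ) * ∫ y, φ (ε • b + ε • y) * ψ y := by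
  set G : E n → ℂ := fun y => φ (ε • b + ε • y) * ψ y with hG
  have h1 : ∀ x, ψ (ε⁻¹ • x - b) * φ x = (fun z => G (z - b)) (ε⁻¹ • x) := by
    intro x
    simp only [hG]
    rw [← smul_add, add_sub_cancel, smul_smul, mul_inv_cancel₀ hε.ne', one_smul, mul_comm]
  rw [integral_congr_ae (.of_forall h1), Measure.integral_comp_smul volume (fun z => G (z - b)),
    integral_sub_right_eq_self G b]
  simp [abs_of_pos hε]

/-- The coefficients of a function with vanishing moments against a wavelet system with vanishing
moments decay rapidly. -/
theorem norm_toSInftyDual_wavelet_le {ψ : 𝓢(E n, ℂ)} (hψ : ψ ∈ SInfty n) (K M : ℕ) :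
    ∃ C : ℝ, 0 ≤ C ∧ ∃ L : ℕ, ∀ (k : ℤ) (m : Fin n → ℤ) (φ : SInfty n),
      ‖toSInftyDual (wavelet ψ k m) φ‖ ≤
        C * ((2 ^ k.natAbs) ^ K)⁻¹ * ((1 + ‖latticePoint m‖) ^ M)⁻¹ * schwartzSup n L φ := by
  -- The `M` extra orders pay, for `k ≥ 0`, for replacing decay in `ε • b` by decay in `b`.
  obtain ⟨C, hC, L, h⟩ := norm_integral_comp_affine_mul_le n (K + M) M
  have hAψ : 0 ≤ schwartzSup n L ψ := apply_nonneg _ _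
  refine ⟨C * schwartzSup n L ψ, by positivity, L, fun k m φ => ?_⟩
  set b := latticePoint m
  have hAφ : 0 ≤ schwartzSup n L (φ : 𝓢(E n, ℂ)) := apply_nonneg _ _
  set ε : ℝ := (2 ^ k.natAbs)⁻¹ with hε
  have hε0 : 0 < ε := by positivity
  have hε1 : ε ≤ 1 := inv_le_one_of_one_le₀ (one_le_pow₀ (by norm_num))
  have hval : toSInftyDual (wavelet ψ k m) φ = (((2 : ℝ) ^ ((k : ℝ) * (n : ℝ) / 2) : ℝ) : ℂ) *
      ∫ x, ψ ((2 : ℝ) ^ k • x - b) * (φ : 𝓢(E n, ℂ)) x := by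
    rw [toSInftyDual_apply, ← integral_const_mul]
    simp only [wavelet_apply, mul_assoc]
    rfl
  have hgoal : C * schwartzSup n L ψ * ((2 ^ k.natAbs) ^ K)⁻¹ * ((1 + ‖b‖) ^ M)⁻¹ *
      schwartzSup n L (φ : 𝓢(E n, ℂ)) = C * ε ^ K * ((1 + ‖b‖) ^ M)⁻¹ *
      (schwartzSup n L ψ * schwartzSup n L (φ : 𝓢(E n, ℂ))) := by
    rw [hε, inv_pow]; ring
  rw [hval, norm_mul, hgoal, Complex.norm_real, Real.norm_of_nonneg (by positivity)]
  -- For `k ≤ 0` the wavelet is the spread-out factor: expand `ψ` and use the moments of `φ`.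
  rcases le_total k 0 with hk | hk
  · have h2k : (2 : ℝ) ^ k = ε := by
      rw [hε, ← zpow_natCast, ← zpow_neg]; congr 1; omega
    have h1 : (2 : ℝ) ^ ((k : ℝ) * (n : ℝ) / 2) ≤ 1 := by
      refine Real.rpow_le_one_of_one_le_of_nonpos (by norm_num) ?_
      have : (k : ℝ) ≤ 0 := by exact_mod_cast hk
      nlinarith [mul_nonneg (neg_nonneg.2 this) (Nat.cast_nonneg (α := ℝ) n)]
    have h2 := h ψ φ ε hε0 hε1 (-b)
    rw [norm_neg] at h2
    simp_rw [h2k, sub_eq_neg_add]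
    refine (mul_le_of_le_one_left (norm_nonneg _) h1).trans (h2.trans ?_)
    gcongr C * ?_ * _ * _
    exact pow_le_pow_of_le_one hε0.le hε1 (by omega)
  -- For `k ≥ 0` the wavelet is concentrated: after rescaling, expand `φ` and use the moments of
  -- `ψ`. The Jacobian `ε ^ n` absorbs the normalising factor `2^{kn/2}`.
  · have h2k : (2 : ℝ) ^ k = ε⁻¹ := by
      rw [hε, inv_inv, ← zpow_natCast]; congr 1; omega
    have h1 : (2 : ℝ) ^ ((k : ℝ) * (n : ℝ) / 2) * ε ^ n ≤ 1 := by
      have h3 : ε ^ n = (2 : ℝ) ^ (-((k : ℝ) * n)) := by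
        rw [← inv_inv ε, ← h2k, inv_pow, Real.rpow_neg (by norm_num), Real.rpow_mul (by norm_num),
          Real.rpow_intCast, Real.rpow_natCast]
      rw [h3, ← Real.rpow_add (by norm_num)]
      refine Real.rpow_le_one_of_one_le_of_nonpos (by norm_num) ?_
      have : (0 : ℝ) ≤ k := by exact_mod_cast hk
      nlinarith [mul_nonneg this (Nat.cast_nonneg (α := ℝ) n)]
    have h2 := h φ ⟨ψ, hψ⟩ ε hε0 hε1 (ε • b)
    rw [h2k, integral_comp_smul_sub_mul _ _ hε0, norm_mul, Complex.norm_real,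
      Real.norm_of_nonneg (by positivity), ← mul_assoc]
    refine (mul_le_of_le_one_left (norm_nonneg _) h1).trans (h2.trans ?_)
    have h4 : ((1 + ‖ε • b‖) ^ M)⁻¹ ≤ (ε ^ M)⁻¹ * ((1 + ‖b‖) ^ M)⁻¹ := by
      rw [← mul_inv, ← mul_pow]
      gcongr
      rw [norm_smul, Real.norm_of_nonneg hε0.le]
      linarith
    calc C * ε ^ (K + M + 1) * ((1 + ‖ε • b‖) ^ M)⁻¹ *
          (schwartzSup n L (φ : 𝓢(E n, ℂ)) * schwartzSup n L ψ)
        ≤ C * ε ^ (K + M) * ((ε ^ M)⁻¹ * ((1 + ‖b‖) ^ M)⁻¹) *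
          (schwartzSup n L (φ : 𝓢(E n, ℂ)) * schwartzSup n L ψ) := by
          gcongr C * ?_ * ?_ * _
          exact pow_le_pow_of_le_one hε0.le hε1 (by omega)
      _ = _ := by rw [pow_add]; field_simp

/-! ### Summability over scales and lattice points -/

/-- Every finite set of indices lies in a finite box, over which the sum of products factors. -/
theorem summable_pi_prod {ι κ : Type*} [Fintype ι] {f : κ → ℝ} (hf0 : ∀ j, 0 ≤ f j)
    (hf : Summable f) : Summable (fun m : ι → κ => ∏ i, f (m i)) := by
  classical
  refine summable_of_sum_le (c := ∏ _i : ι, ∑' j, f j)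
    (fun m => Finset.prod_nonneg fun i _ => hf0 _) fun s => ?_
  have hs : s ⊆ Fintype.piFinset fun i => s.image (fun m => m i) := fun m hm =>
    Fintype.mem_piFinset.2 fun i => Finset.mem_image_of_mem (fun m => m i) hm
  refine (Finset.sum_le_sum_of_subset_of_nonneg hs
    fun m _ _ => Finset.prod_nonneg fun i _ => hf0 _).trans ?_
  rw [← Finset.prod_univ_sum (fun i => s.image (fun m => m i)) (fun _ j => f j)]
  exact Finset.prod_le_prod (fun i _ => Finset.sum_nonneg fun j _ => hf0 j)
    fun i _ => hf.sum_le_tsum _ fun j _ => hf0 j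

theorem summable_int_one_add_abs : Summable (fun j : ℤ => ((1 + |(j : ℝ)|) ^ 2)⁻¹) := by
  have h : Summable (fun j : ℤ => (|(j : ℝ)| ^ 2)⁻¹) := by
    simpa [sq_abs, one_div] using (Real.summable_one_div_int_pow (p := 2)).2 (by norm_num)
  -- The term of `h` at `j = 0` is `0⁻¹ = 0`, so the majorant needs an extra `1` there.
  refine (h.add (summable_of_ne_finset_zero (s := {0})
    (f := fun j : ℤ => if j = 0 then (1 : ℝ) else 0) (by intro j hj; simp_all))).of_nonneg_of_le
    (fun j => by positivity) fun j => ?_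
  by_cases hj : j = 0
  · simp [hj]
  · have : 0 < |(j : ℝ)| := by positivity
    simp only [hj, if_false, add_zero]
    gcongr
    linarith

theorem summable_lattice (n : ℕ) : Summable (fun p : ℤ × (Fin n → ℤ) =>
    ((2 ^ p.1.natAbs) ^ 1 : ℝ)⁻¹ * ((1 + ‖latticePoint p.2‖) ^ (2 * n))⁻¹) := by
  have h1 : Summable (fun k : ℤ => ((2 ^ k.natAbs) ^ 1 : ℝ)⁻¹) := by
    have h : Summable (fun k : ℕ => ((1 : ℝ) / 2) ^ k) := summable_geometric_two
    refine Summable.of_nat_of_neg ?_ ?_ <;> simpa using h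
  have h2 : Summable (fun m : Fin n → ℤ => ((1 + ‖latticePoint m‖) ^ (2 * n))⁻¹) := by
    refine (summable_pi_prod (ι := Fin n) (fun j => by positivity)
      summable_int_one_add_abs).of_nonneg_of_le (fun m => by positivity) fun m => ?_
    rw [Finset.prod_inv_distrib, Finset.prod_pow]
    -- This is why the exponent is `2 * n`: two powers for each coordinate.
    have h3 : ∏ i, (1 + |(m i : ℝ)|) ≤ (1 + ‖latticePoint m‖) ^ n := by
      refine (Finset.prod_le_prod (fun i _ => by positivity) fun i _ =>
        add_le_add_right (?_ : |(m i : ℝ)| ≤ ‖latticePoint m‖) 1).trans_eq (by simp)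
      exact PiLp.norm_apply_le (latticePoint m) i
    have h4 : 0 < ∏ i, (1 + |(m i : ℝ)|) := Finset.prod_pos fun i _ => by positivity
    rw [mul_comm 2 n, pow_mul]
    gcongr
  exact h1.mul_of_nonneg h2 (fun _ => by positivity) (fun _ => by positivity)

/-! ### Cubes and means of weights -/

theorem cube_eq_preimage (a : Fin n → ℝ) (l : ℝ) :
    cube a l = WithLp.ofLp ⁻¹' (Set.univ.pi fun i => Set.Ico (a i) (a i + l)) := by
  ext x; simp [cube]

theorem measurableSet_cube (a : Fin n → ℝ) (l : ℝ) : MeasurableSet (cube a l) := by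
  rw [cube_eq_preimage]
  exact (PiLp.volume_preserving_ofLp (Fin n)).measurable
    (MeasurableSet.univ_pi fun _ => measurableSet_Ico)

theorem volume_cube (a : Fin n → ℝ) (l : ℝ) : volume (cube a l) = ENNReal.ofReal l ^ n := by
  rw [cube_eq_preimage, (PiLp.volume_preserving_ofLp (Fin n)).measure_preimage
    (MeasurableSet.univ_pi fun _ => measurableSet_Ico).nullMeasurableSet, Real.volume_pi_Ico]
  simp

theorem volume_cube_ne_zero (a : Fin n → ℝ) {l : ℝ} (hl : 0 < l) : volume (cube a l) ≠ 0 := by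
  rw [volume_cube]
  exact pow_ne_zero _ (ENNReal.ofReal_pos.2 hl).ne'

theorem volume_cube_ne_top (a : Fin n → ℝ) (l : ℝ) : volume (cube a l) ≠ ∞ := by
  rw [volume_cube]
  exact ENNReal.pow_ne_top ENNReal.ofReal_ne_top

theorem exists_isCompact_cube_subset (a : Fin n → ℝ) (l : ℝ) :
    ∃ K : Set (E n), IsCompact K ∧ cube a l ⊆ K := by
  refine ⟨WithLp.toLp 2 '' (Set.univ.pi fun i => Set.Icc (a i) (a i + l)),
    (isCompact_univ_pi fun _ => isCompact_Icc).image (PiLp.continuous_toLp 2 _), fun x hx => ?_⟩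
  exact ⟨WithLp.ofLp x, fun i _ => ⟨(hx i).1, (hx i).2.le⟩, rfl⟩

theorem cube_subset_cube {a b : Fin n → ℝ} {l r : ℝ} (h : ∀ i, b i ≤ a i ∧ a i + l ≤ b i + r) :
    cube a l ⊆ cube b r := fun _ hx i =>
  ⟨(h i).1.trans (hx i).1, (hx i).2.trans_le (h i).2⟩

theorem lpMean_eq {A : Set (E n)} (hA : volume A ≠ ∞) (p : ℝ≥0∞) (f : E n → ℝ) :
    lpMean A p f = (volume A)⁻¹ ^ (1 / p).toReal * eLpNorm f p (volume.restrict A) := by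
  rw [lpMean, eLpNorm_smul_measure_of_ne_zero (ENNReal.inv_ne_zero.2 hA), smul_eq_mul]

/-- Enlarging the set increases the mean at most by a power of the ratio of the volumes. -/
theorem lpMean_le_of_subset {A R : Set (E n)} (hAR : A ⊆ R) (hA : volume A ≠ 0)
    (hR : volume R ≠ ∞) {V : ℝ≥0∞} (hV : volume R ≤ V * volume A) (p : ℝ≥0∞) (f : E n → ℝ) :
    lpMean A p f ≤ V ^ (1 / p).toReal * lpMean R p f := by
  have hA' : volume A ≠ ∞ := ne_top_of_le_ne_top hR (measure_mono hAR)
  have hR' : volume R ≠ 0 := fun h => hA (measure_mono_null hAR h)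
  rw [lpMean_eq hA', lpMean_eq hR, ← mul_assoc,
    ← ENNReal.mul_rpow_of_nonneg _ _ ENNReal.toReal_nonneg]
  gcongr
  rw [← div_eq_mul_inv, ENNReal.le_div_iff_mul_le (.inl hR') (.inl hR), mul_comm,
    ← div_eq_mul_inv]
  exact ENNReal.div_le_of_le_mul hV

theorem isProbabilityMeasure_inv_smul_restrict {A : Set (E n)} (h0 : volume A ≠ 0)
    (hA : volume A ≠ ∞) :
    IsProbabilityMeasure ((volume A)⁻¹ • (volume : Measure (E n)).restrict A) :=
  ⟨by simp [ENNReal.inv_mul_cancel h0 hA]⟩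

theorem inv_smul_restrict_absolutelyContinuous (A : Set (E n)) :
    (volume A)⁻¹ • (volume : Measure (E n)).restrict A ≪ volume :=
  Measure.absolutelyContinuous_of_le_smul (c := (volume A)⁻¹)
    (by gcongr; exact Measure.restrict_le_self)

theorem IsWeight.aestronglyMeasurable {t : E n → ℝ} (ht : IsWeight t) :
    AEStronglyMeasurable t volume :=
  ht.locallyIntegrable.aestronglyMeasurable

theorem lpMean_mono_exponent {A : Set (E n)} (h0 : volume A ≠ 0) (hA : volume A ≠ ∞)
    {p r : ℝ≥0∞} (hpr : p ≤ r) {t : E n → ℝ} (ht : IsWeight t) :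
    lpMean A p t ≤ lpMean A r t :=
  have := isProbabilityMeasure_inv_smul_restrict h0 hA
  eLpNorm_le_eLpNorm_of_exponent_le hpr
    (ht.aestronglyMeasurable.mono_ac (inv_smul_restrict_absolutelyContinuous A))

/-- Hölder's inequality for a weight and its reciprocal. -/
theorem one_le_lpMean_mul_lpMean_inv {A : Set (E n)} (h0 : volume A ≠ 0) (hA : volume A ≠ ∞)
    {p r s : ℝ≥0∞} (hprs : ENNReal.HolderTriple p r s) (hs : s ≠ 0) {t : E n → ℝ}
    (ht : IsWeight t) : 1 ≤ lpMean A p t * lpMean A r (fun x => (t x)⁻¹) := by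
  have := isProbabilityMeasure_inv_smul_restrict h0 hA
  have hac := inv_smul_restrict_absolutelyContinuous A
  have hm := ht.aestronglyMeasurable.mono_ac hac
  have h1 := eLpNorm_smul_le_mul_eLpNorm (p := p) (q := r) (r := s)
    (f := fun x => (t x)⁻¹) (φ := t) hm.aemeasurable.inv.aestronglyMeasurable hm
  refine le_of_eq_of_le ?_ h1
  have h2 : (t • fun x => (t x)⁻¹) =ᵐ[(volume A)⁻¹ • volume.restrict A] fun _ => (1 : ℝ) := by
    filter_upwards [hac.ae_le ht.ae_pos] with x hx
    simp [hx.ne']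
  rw [eLpNorm_congr_ae h2, eLpNorm_const _ hs (IsProbabilityMeasure.ne_zero _)]
  simp

theorem lpMean_ne_zero {A : Set (E n)} (h0 : volume A ≠ 0) (hA : volume A ≠ ∞)
    {p : ℝ≥0∞} (hp : p ≠ 0) {t : E n → ℝ} (ht : IsWeight t) : lpMean A p t ≠ 0 := by
  have := isProbabilityMeasure_inv_smul_restrict h0 hA
  have hac := inv_smul_restrict_absolutelyContinuous A
  intro h
  rw [lpMean, eLpNorm_eq_zero_iff (ht.aestronglyMeasurable.mono_ac hac) hp] at h
  obtain ⟨x, hx, hx'⟩ := (h.and (hac.ae_le ht.ae_pos)).exists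
  exact hx'.ne' hx

theorem IsAdmissible.lpMean_cube_ne_top {p : ℝ≥0∞} {t : ℤ → E n → ℝ} (ht : IsAdmissible p t)
    (k : ℤ) (a : Fin n → ℝ) {l : ℝ} (hl : 0 < l) : lpMean (cube a l) p (t k) ≠ ∞ := by
  obtain ⟨K, hK, hsub⟩ := exists_isCompact_cube_subset a l
  rw [lpMean_eq (volume_cube_ne_top a l)]
  refine ENNReal.mul_ne_top (ENNReal.rpow_ne_top_of_nonneg ENNReal.toReal_nonneg
    (ENNReal.inv_ne_top.2 (volume_cube_ne_zero a hl))) ?_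
  exact ((ht.memLp k K hK).mono_measure (Measure.restrict_mono hsub le_rfl)).2.ne

/-- Dividing `θ/q + 1/(q/θ)' = 1` by `θ` gives `1/q + 1/σ₁ = 1/θ`; the endpoint `θ = q`, `σ₁ = ∞` is
included. -/
theorem holderTriple_mul_conjExponent {θ q : ℝ} (hθ : 0 < θ) (hθq : θ ≤ q) :
    ENNReal.HolderTriple (ENNReal.ofReal q)
      (ENNReal.ofReal θ * ENNReal.conjExponent (ENNReal.ofReal (q / θ))) (ENNReal.ofReal θ) := by
  have h1 : (1 : ℝ≥0∞) ≤ ENNReal.ofReal (q / θ) := by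
    rw [← ENNReal.ofReal_one]
    exact ENNReal.ofReal_le_ofReal ((one_le_div hθ).2 hθq)
  have h2 := ENNReal.holderConjugate_iff.1 (ENNReal.HolderConjugate.conjExponent h1)
  have hθ0 : ENNReal.ofReal θ ≠ 0 := (ENNReal.ofReal_pos.2 hθ).ne'
  have h3 : ENNReal.ofReal q = ENNReal.ofReal θ * ENNReal.ofReal (q / θ) := by
    rw [← ENNReal.ofReal_mul hθ.le, mul_div_cancel₀ _ hθ.ne']
  refine ⟨?_⟩
  rw [h3, ENNReal.mul_inv (.inl hθ0) (.inl ENNReal.ofReal_ne_top),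
    ENNReal.mul_inv (.inl hθ0) (.inl ENNReal.ofReal_ne_top), ← mul_add, h2, mul_one]

/-! ### Polynomial growth of the coefficients -/

/-- The quasi-norm controls each coefficient. -/
theorem enorm_mul_lpMean_le_fInftyNorm {q : ℝ} (hq : 0 < q) (t : ℤ → E n → ℝ)
    (lam : ℤ → (Fin n → ℤ) → ℂ) (k : ℤ) (m : Fin n → ℤ) :
    (2 : ℝ≥0∞) ^ ((k : ℝ) * n / 2) * ‖lam k m‖ₑ *
      lpMean (dyadicCube k m) (ENNReal.ofReal q) (t k) ≤ fInftyNorm q t lam := by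
  set Q := dyadicCube k m with hQ
  have hmQ : MeasurableSet Q := measurableSet_cube _ _
  set c : ℝ≥0∞ := (2 : ℝ≥0∞) ^ ((k : ℝ) * n * q / 2) * ‖lam k m‖ₑ ^ q with hc
  have hcr : c ^ (1 / q) = (2 : ℝ≥0∞) ^ ((k : ℝ) * n / 2) * ‖lam k m‖ₑ := by
    rw [hc, ENNReal.mul_rpow_of_nonneg _ _ (by positivity), ← ENNReal.rpow_mul,
      ← ENNReal.rpow_mul, mul_one_div_cancel hq.ne', ENNReal.rpow_one]
    congr 2
    field_simp
  have hctop : c ≠ ∞ := by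
    rw [hc]
    exact ENNReal.mul_ne_top (ENNReal.rpow_ne_top_of_ne_zero (by norm_num) (by norm_num))
      (ENNReal.rpow_ne_top_of_nonneg hq.le enorm_ne_top)
  have hmean : lpMean Q (ENNReal.ofReal q) (t k) =
      ((volume Q)⁻¹ * ∫⁻ x in Q, ‖t k x‖ₑ ^ q) ^ (1 / q) := by
    rw [lpMean, eLpNorm_eq_lintegral_rpow_enorm_toReal (ENNReal.ofReal_pos.2 hq).ne'
      ENNReal.ofReal_ne_top, ENNReal.toReal_ofReal hq.le, lintegral_smul_measure, smul_eq_mul]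
  rw [hmean, ← hcr, ← ENNReal.mul_rpow_of_nonneg _ _ (by positivity)]
  -- Test the supremum on `P = Q_{k,m}` itself and keep only the summand `(k, m)`.
  refine le_trans ?_ (le_iSup₂ (f := fun (j : ℤ) (h : Fin n → ℤ) =>
    ((volume (dyadicCube j h))⁻¹ * ∫⁻ x in dyadicCube j h,
      ∑' k : {k : ℤ // j ≤ k}, ∑' m : Fin n → ℤ,
        (dyadicCube (k : ℤ) m).indicator
          (fun y => (2 : ℝ≥0∞) ^ (((k : ℤ) : ℝ) * (n : ℝ) * q / 2) *
            ‖t (k : ℤ) y‖ₑ ^ q * ‖lam (k : ℤ) m‖ₑ ^ q) x) ^ (1 / q)) k m)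
  refine ENNReal.rpow_le_rpow ?_ (by positivity)
  rw [mul_left_comm, ← lintegral_const_mul' _ _ hctop]
  refine mul_le_mul_right (setLIntegral_mono' hmQ fun x hx => ?_) _
  refine le_trans ?_ (ENNReal.le_tsum (⟨k, le_rfl⟩ : {k' : ℤ // k ≤ k'}))
  refine le_trans ?_ (ENNReal.le_tsum m)
  rw [Set.indicator_of_mem hx, hc]
  exact le_of_eq (by ring)

theorem two_rpow_mul_le_pow_natAbs (α : ℝ) (k : ℤ) {a : ℕ} (ha : |α| ≤ a) :
    (2 : ℝ) ^ (α * k) ≤ (2 ^ k.natAbs) ^ a := by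
  rw [← Real.rpow_natCast, ← Real.rpow_natCast, ← Real.rpow_mul (by norm_num)]
  refine Real.rpow_le_rpow_of_exponent_le (by norm_num) ?_
  rw [Nat.cast_natAbs, Int.cast_abs, mul_comm]
  calc (k : ℝ) * α ≤ |(k : ℝ) * α| := le_abs_self _
    _ = |(k : ℝ)| * |α| := abs_mul _ _
    _ ≤ _ := by gcongr

/-- For `k ≥ 0` this is the first class condition for the pair `(0, k)`. For `k ≤ 0` that pair is in
the wrong order: the second condition, with `p ≤ σ₂`, first replaces `t 0` by `t k`, and the first
condition is then applied to `(k, k)`. -/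
theorem InClassX.exists_lpMean_mul_lpMean_inv_le {α₁ α₂ : ℝ} {σ₁ σ₂ p : ℝ≥0∞} {t : ℤ → E n → ℝ}
    (ht : InClassX α₁ α₂ σ₁ σ₂ p t) (hp : p ≠ 0) (hσ₂ : p ≤ σ₂) :
    ∃ C : ℝ, 0 ≤ C ∧ ∃ a : ℕ, ∀ (k : ℤ) (b : Fin n → ℝ) (l : ℝ), 0 < l →
      lpMean (cube b l) p (t 0) * lpMean (cube b l) σ₁ (fun x => (t k x)⁻¹) ≤
        ENNReal.ofReal (C * (2 ^ k.natAbs) ^ a) := by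
  obtain ⟨C₁, hC₁, h₁⟩ := ht.bound₁
  obtain ⟨C₂, hC₂, h₂⟩ := ht.bound₂
  refine ⟨C₁ * (1 + C₂), by positivity, ⌈|α₁|⌉₊ + ⌈|α₂|⌉₊, fun k b l hl => ?_⟩
  have hle (α : ℝ) {a : ℕ} (ha : |α| ≤ a) := two_rpow_mul_le_pow_natAbs α k ha
  have hone : (1 : ℝ) ≤ 2 ^ k.natAbs := one_le_pow₀ (by norm_num)
  rcases le_total 0 k with hk | hk
  · refine (h₁ 0 k hk b l hl).trans (ENNReal.ofReal_le_ofReal ?_)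
    have h3 : (2 : ℝ) ^ (α₁ * (((0 : ℤ) : ℝ) - k)) ≤ (2 ^ k.natAbs) ^ (⌈|α₁|⌉₊ + ⌈|α₂|⌉₊) := by
      rw [Int.cast_zero, zero_sub, mul_neg, ← neg_mul]
      refine hle _ ?_
      rw [abs_neg]
      push_cast
      linarith [Nat.le_ceil |α₁|, Nat.cast_nonneg (α := ℝ) ⌈|α₂|⌉₊]
    calc _ ≤ C₁ * (2 ^ k.natAbs) ^ (⌈|α₁|⌉₊ + ⌈|α₂|⌉₊) := by gcongr
      _ ≤ _ := by gcongr; nlinarith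
  · have h0 := volume_cube_ne_zero b hl
    have hT := volume_cube_ne_top b l
    have hx0 := lpMean_ne_zero h0 hT hp (ht.isAdmissible.isWeight k)
    have hxT := ht.isAdmissible.lpMean_cube_ne_top k b hl
    set D : ℝ := C₂ * (2 : ℝ) ^ (α₂ * (((0 : ℤ) : ℝ) - k)) with hD
    have h3 : lpMean (cube b l) p (t 0) ≤ lpMean (cube b l) p (t k) * ENNReal.ofReal D := by
      refine (lpMean_mono_exponent h0 hT hσ₂ (ht.isAdmissible.isWeight 0)).trans ?_
      calc lpMean (cube b l) σ₂ (t 0) = lpMean (cube b l) p (t k) *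
            ((lpMean (cube b l) p (t k))⁻¹ * lpMean (cube b l) σ₂ (t 0)) := by
            rw [← mul_assoc, ENNReal.mul_inv_cancel hx0 hxT, one_mul]
        _ ≤ _ := by gcongr; exact h₂ k 0 hk b l hl
    have h4 : lpMean (cube b l) p (t k) * lpMean (cube b l) σ₁ (fun x => (t k x)⁻¹) ≤
        ENNReal.ofReal C₁ := by simpa using h₁ k k le_rfl b l hl
    have h5 : (2 : ℝ) ^ (α₂ * (((0 : ℤ) : ℝ) - k)) ≤ (2 ^ k.natAbs) ^ (⌈|α₁|⌉₊ + ⌈|α₂|⌉₊) := by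
      rw [Int.cast_zero, zero_sub, mul_neg, ← neg_mul]
      refine hle _ ?_
      rw [abs_neg]
      push_cast
      linarith [Nat.le_ceil |α₂|, Nat.cast_nonneg (α := ℝ) ⌈|α₁|⌉₊]
    calc _ ≤ (lpMean (cube b l) p (t k) * ENNReal.ofReal D) *
          lpMean (cube b l) σ₁ (fun x => (t k x)⁻¹) := by gcongr
      _ = (lpMean (cube b l) p (t k) * lpMean (cube b l) σ₁ (fun x => (t k x)⁻¹)) *
          ENNReal.ofReal D := by ring
      _ ≤ ENNReal.ofReal C₁ * ENNReal.ofReal D := by gcongr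
      _ = ENNReal.ofReal (C₁ * D) := (ENNReal.ofReal_mul hC₁.le).symm
      _ ≤ _ := by
        refine ENNReal.ofReal_le_ofReal ?_
        rw [mul_assoc, hD]
        gcongr
        linarith

/-- The coefficients of a sequence in `ḟ_{∞,q}` grow at most polynomially in `2^|k|` and `m`. -/
theorem InClassX.exists_enorm_le_fInftyNorm {α₁ α₂ q : ℝ} (hq : 0 < q) {σ₁ σ₂ s : ℝ≥0∞}
    {t : ℤ → E n → ℝ} (ht : InClassX α₁ α₂ σ₁ σ₂ (ENNReal.ofReal q) t)
    (hs : s ≠ 0) (hσ₁ : ENNReal.HolderTriple (ENNReal.ofReal q) σ₁ s)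
    (hσ₂ : ENNReal.ofReal q ≤ σ₂) :
    ∃ C : ℝ, 0 ≤ C ∧ ∃ A B : ℕ, ∀ (lam : ℤ → (Fin n → ℤ) → ℂ) (k : ℤ) (m : Fin n → ℤ),
      ‖lam k m‖ₑ ≤ ENNReal.ofReal (C * (2 ^ k.natAbs) ^ A * (1 + ‖latticePoint m‖) ^ B) *
        fInftyNorm q t lam := by
  set p := ENNReal.ofReal q with hp
  have hp0 : p ≠ 0 := (ENNReal.ofReal_pos.2 hq).ne'
  obtain ⟨C, hC, a, h⟩ := ht.exists_lpMean_mul_lpMean_inv_le hp0 hσ₂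
  set m₀ := lpMean (cube (fun _ : Fin n => (0 : ℝ)) 1) p (t 0) with hm₀
  have hm₀0 : m₀ ≠ 0 := lpMean_ne_zero (volume_cube_ne_zero _ one_pos) (volume_cube_ne_top _ _) hp0
    (ht.isAdmissible.isWeight 0)
  have hm₀T : m₀ ≠ ∞ := ht.isAdmissible.lpMean_cube_ne_top 0 _ one_pos
  set w : ℕ := ⌈(1 / p).toReal + (1 / σ₁).toReal⌉₊ with hw
  refine ⟨m₀⁻¹.toReal * C * 4 ^ (n * w), by positivity, a + n * w + n, n * w,
    fun lam k m => ?_⟩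
  set F := fInftyNorm q t lam
  set y : ℝ := 1 + ‖latticePoint m‖ with hy
  have hy1 : 1 ≤ y := by linarith [norm_nonneg (latticePoint m)]
  set D : ℝ := 2 ^ k.natAbs with hD
  have hD1 : 1 ≤ D := one_le_pow₀ (by norm_num)
  set e : ℝ := (2 : ℝ) ^ (-k) with he
  have he0 : 0 < e := by positivity
  have heD : e ≤ D := by
    rw [he, hD, ← zpow_natCast]
    exact zpow_le_zpow_right₀ (by norm_num) (by omega)
  have hDe : 1 ≤ D * e := by
    rw [he, hD, ← zpow_natCast, ← zpow_add₀ (by norm_num)]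
    exact one_le_zpow₀ (by norm_num) (by omega)
  set V : ℝ≥0∞ := ENNReal.ofReal ((4 * D * y) ^ n) with hV
  have hW1 : 1 ≤ 4 * D * y := by nlinarith
  have hV1 : 1 ≤ V := by
    rw [hV, ← ENNReal.ofReal_one]
    exact ENNReal.ofReal_le_ofReal (one_le_pow₀ hW1)
  -- The centred cube `R` of side `2 * l` contains both `Q` and the unit cube; its volume exceeds
  -- either of theirs by a factor of at most `V`.
  set l : ℝ := e * y + 1 with hl
  have hl0 : 0 < 2 * l := by positivity
  set R : Set (E n) := cube (fun _ => -l) (2 * l) with hR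
  set Q : Set (E n) := dyadicCube k m with hQ
  have hm (i : Fin n) : |(m i : ℝ)| ≤ y - 1 := by
    rw [hy, add_sub_cancel_left]
    exact PiLp.norm_apply_le (latticePoint m) i
  have hQR : Q ⊆ R := cube_subset_cube fun i => by
    have := abs_le.1 (hm i)
    constructor <;> nlinarith
  have hQ0R : cube (fun _ : Fin n => (0 : ℝ)) 1 ⊆ R := cube_subset_cube fun i => by
    have : 0 < e * y := by positivity
    constructor <;> linarith
  have hvol (b : Fin n → ℝ) (r : ℝ) (hr : 2 * l ≤ 4 * D * y * r) :
      volume R ≤ V * volume (cube b r) := by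
    rw [hR, volume_cube, volume_cube, hV, ENNReal.ofReal_pow (by positivity), ← mul_pow,
      ← ENNReal.ofReal_mul (by positivity)]
    gcongr
  have hvolQ : volume R ≤ V * volume Q := by
    refine hvol _ _ ?_
    have h1 : 0 ≤ (D - 1) * (e * y) := mul_nonneg (by linarith) (by positivity)
    have h2 : 0 ≤ (D * e - 1) * y := mul_nonneg (by linarith) (by positivity)
    nlinarith
  have hvolQ0 : volume R ≤ V * volume (cube (fun _ : Fin n => (0 : ℝ)) 1) := by
    refine hvol _ _ ?_
    have h1 : 0 ≤ (D - e) * y := mul_nonneg (by linarith) (by positivity)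
    have h2 : 1 ≤ D * y := one_le_mul_of_one_le_of_one_le hD1 hy1
    nlinarith
  have hRT : volume R ≠ ∞ := volume_cube_ne_top _ _
  have hQ0 : volume Q ≠ 0 := volume_cube_ne_zero _ he0
  set X := lpMean Q p (t k) with hX
  have hone : 1 ≤ X * (V ^ (1 / σ₁).toReal * lpMean R σ₁ (fun x => (t k x)⁻¹)) :=
    (one_le_lpMean_mul_lpMean_inv hQ0 (volume_cube_ne_top _ _) hσ₁ hs
      (ht.isAdmissible.isWeight k)).trans
      (by gcongr; exact lpMean_le_of_subset hQR hQ0 hRT hvolQ _ _)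
  have hm₀le : m₀ ≤ V ^ (1 / p).toReal * lpMean R p (t 0) :=
    lpMean_le_of_subset hQ0R (volume_cube_ne_zero _ one_pos) hRT hvolQ0 _ _
  have hVw : V ^ (1 / p).toReal * V ^ (1 / σ₁).toReal ≤ ENNReal.ofReal ((4 * D * y) ^ (n * w)) := by
    rw [← ENNReal.rpow_add_of_nonneg _ _ ENNReal.toReal_nonneg ENNReal.toReal_nonneg, pow_mul,
      ENNReal.ofReal_pow (by positivity), ← ENNReal.rpow_natCast]
    exact ENNReal.rpow_le_rpow_of_exponent_le hV1 (Nat.le_ceil _)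
  have hXlam : X * ‖lam k m‖ₑ ≤ ENNReal.ofReal (D ^ n) * F := by
    have h1 := enorm_mul_lpMean_le_fInftyNorm hq t lam k m
    have h2 : (2 : ℝ≥0∞) ^ (-((k : ℝ) * n / 2)) ≤ ENNReal.ofReal (D ^ n) := by
      have h3 : (2 : ℝ≥0∞) ^ (-((k : ℝ) * n / 2)) =
          ENNReal.ofReal ((2 : ℝ) ^ (-((n : ℝ) / 2) * k)) := by
        rw [← ENNReal.ofReal_rpow_of_pos (by norm_num), ENNReal.ofReal_ofNat]
        congr 1
        ring
      rw [h3]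
      refine ENNReal.ofReal_le_ofReal (two_rpow_mul_le_pow_natAbs _ _ ?_)
      rw [abs_neg, abs_of_nonneg (by positivity)]
      linarith [Nat.cast_nonneg (α := ℝ) n]
    calc X * ‖lam k m‖ₑ = (2 : ℝ≥0∞) ^ (-((k : ℝ) * n / 2)) *
          ((2 : ℝ≥0∞) ^ ((k : ℝ) * n / 2) * ‖lam k m‖ₑ * X) := by
          rw [← mul_assoc, ← mul_assoc, ← ENNReal.rpow_add _ _ (by norm_num) (by norm_num),
            neg_add_cancel, ENNReal.rpow_zero, one_mul, mul_comm]
      _ ≤ _ := by gcongr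
  have hmain : m₀ * ‖lam k m‖ₑ ≤
      ENNReal.ofReal (C * D ^ a * (4 * D * y) ^ (n * w) * D ^ n) * F := by
    -- Inserting the Hölder factor `hone`, which is at least `1`, supplies the mean `X` needed to
    -- control `lam k m` and pairs `t 0` with the reciprocal of `t k` on the same cube `R`.
    calc m₀ * ‖lam k m‖ₑ ≤ (V ^ (1 / p).toReal * lpMean R p (t 0)) * ‖lam k m‖ₑ *
          (X * (V ^ (1 / σ₁).toReal * lpMean R σ₁ (fun x => (t k x)⁻¹))) := by
          refine (mul_le_mul_left hm₀le _).trans ?_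
          exact le_mul_of_one_le_right zero_le hone
      _ = (lpMean R p (t 0) * lpMean R σ₁ (fun x => (t k x)⁻¹)) *
          (V ^ (1 / p).toReal * V ^ (1 / σ₁).toReal) * (X * ‖lam k m‖ₑ) := by ring
      _ ≤ ENNReal.ofReal (C * D ^ a) * ENNReal.ofReal ((4 * D * y) ^ (n * w)) *
          (ENNReal.ofReal (D ^ n) * F) := by
          gcongr
          exact h k _ _ hl0
      _ = _ := by
          rw [← mul_assoc, ← ENNReal.ofReal_mul (by positivity), ← ENNReal.ofReal_mul (by positivity)]
  calc ‖lam k m‖ₑ = m₀⁻¹ * (m₀ * ‖lam k m‖ₑ) := by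
        rw [← mul_assoc, ENNReal.inv_mul_cancel hm₀0 hm₀T, one_mul]
    _ ≤ m₀⁻¹ * (ENNReal.ofReal (C * D ^ a * (4 * D * y) ^ (n * w) * D ^ n) * F) := by gcongr
    _ = _ := by
        nth_rw 1 [← ENNReal.ofReal_toReal (ENNReal.inv_ne_top.2 hm₀0)]
        rw [← mul_assoc, ← ENNReal.ofReal_mul ENNReal.toReal_nonneg]
        congr 2
        rw [mul_pow, mul_pow, pow_add, pow_add]
        ring

/-! ### Convergence and continuity in the strong dual -/

theorem _root_.Bornology.IsVonNBounded.exists_seminorm_le {V : Type*} [AddCommGroup V] [Module ℂ V]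
    [TopologicalSpace V] {S : Set V} (hS : Bornology.IsVonNBounded ℂ S) {P : Seminorm ℂ V}
    (hP : Continuous P) : ∃ c : ℝ, 0 < c ∧ ∀ x ∈ S, P x ≤ c := by
  have hmem : P.ball 0 1 ∈ 𝓝 (0 : V) := by
    rw [P.ball_zero_eq]
    exact hP.continuousAt.preimage_mem_nhds (Iio_mem_nhds (by simp))
  obtain ⟨r, hr, h⟩ := (hS hmem).exists_pos
  refine ⟨r, hr, fun x hx => ?_⟩
  obtain ⟨y, hy, rfl⟩ := h (r : ℂ) (by simp [abs_of_pos hr]) hx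
  simp only [map_smul_eq_mul, Complex.norm_real, Real.norm_of_nonneg hr.le]
  exact mul_le_of_le_one_right hr.le (P.mem_ball_zero.1 hy).le

/-- A family of functionals dominated by a summable multiple of a continuous seminorm is summable
in the strong dual. -/
theorem summable_of_norm_apply_le_seminorm {V ι : Type*} [AddCommGroup V] [Module ℂ V]
    [TopologicalSpace V] [IsTopologicalAddGroup V] [ContinuousSMul ℂ V] [SequentialSpace V]
    {P : Seminorm ℂ V} (hP : Continuous P) {T : ι → V →L[ℂ] ℂ} {w : ι → ℝ} (hw0 : ∀ i, 0 ≤ w i)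
    (hw : Summable w) (hT : ∀ i x, ‖T i x‖ ≤ w i * P x) : Summable T := by
  -- The Cauchy criterion suffices because the strong dual of a sequential space is complete.
  rw [summable_iff_vanishing]
  intro e he
  obtain ⟨⟨S, U⟩, ⟨hS, hU⟩, hSU⟩ := ContinuousLinearMap.hasBasis_nhds_zero.mem_iff.1 he
  change Bornology.IsVonNBounded ℂ S at hS
  obtain ⟨δ, hδ, hball⟩ := Metric.mem_nhds_iff.1 hU
  obtain ⟨c, hc, hcS⟩ := hS.exists_seminorm_le hP
  obtain ⟨s, hs⟩ := summable_iff_vanishing.1 hw (Metric.ball 0 (δ / (c + 1)))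
    (Metric.ball_mem_nhds _ (by positivity))
  refine ⟨s, fun u hu => hSU fun x hx => hball ?_⟩
  have h1 := hs u hu
  rw [mem_ball_zero_iff, Real.norm_of_nonneg (Finset.sum_nonneg fun i _ => hw0 i),
    lt_div_iff₀ (by positivity)] at h1
  rw [mem_ball_zero_iff, sum_apply]
  calc ‖∑ i ∈ u, T i x‖ ≤ ∑ i ∈ u, w i * P x := norm_sum_le_of_le _ fun i _ => hT i x
    _ = (∑ i ∈ u, w i) * P x := (Finset.sum_mul _ _ _).symm
    _ ≤ (∑ i ∈ u, w i) * (c + 1) := by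
        gcongr
        · exact Finset.sum_nonneg fun i _ => hw0 i
        · linarith [hcS x hx]
    _ < δ := h1

theorem continuous_schwartzSup (n L : ℕ) : Continuous (schwartzSup n L) := by
  rw [schwartzSup]
  generalize Finset.Iic (L, L) = s
  classical
  induction s using Finset.induction_on with
  | empty => exact continuous_const
  | insert a s ha ih =>
    rw [Finset.sup_insert, Seminorm.coe_sup]
    exact ((schwartz_withSeminorms ℂ (E n) ℂ).continuous_seminorm a).sup ih

/-- The coefficient functionals are dominated by a summable multiple of a continuous seminorm,
with a constant proportional to the quasi-norm. -/
theorem exists_norm_seriesTerm_le {α₁ α₂ q : ℝ} (hq : 0 < q) {σ₁ σ₂ s : ℝ≥0∞}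
    {t : ℤ → E n → ℝ} (ht : InClassX α₁ α₂ σ₁ σ₂ (ENNReal.ofReal q) t)
    (hs : s ≠ 0) (hσ₁ : ENNReal.HolderTriple (ENNReal.ofReal q) σ₁ s)
    (hσ₂ : ENNReal.ofReal q ≤ σ₂) {ψ : 𝓢(E n, ℂ)} (hψ : ψ ∈ SInfty n) :
    ∃ (P : Seminorm ℂ (SInfty n)) (w : ℤ × (Fin n → ℤ) → ℝ), Continuous P ∧ (∀ p, 0 ≤ w p) ∧
      Summable w ∧ ∀ lam : ℤ → (Fin n → ℤ) → ℂ, fInftyNorm q t lam ≠ ∞ → ∀ p φ,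
        ‖seriesTerm ψ lam p φ‖ ≤ (fInftyNorm q t lam).toReal * w p * P φ := by
  obtain ⟨C, hC, A, B, h⟩ := ht.exists_enorm_le_fInftyNorm hq hs hσ₁ hσ₂
  -- The orders `A` and `B` cancel the growth of the coefficients; the surplus `1` and `2 * n`
  -- leaves the summable weight of `summable_lattice`.
  obtain ⟨C', hC', L, h'⟩ := norm_toSInftyDual_wavelet_le hψ (A + 1) (B + 2 * n)
  refine ⟨(schwartzSup n L).comp (SInfty n).subtype, fun p => C * C' *
    (((2 ^ p.1.natAbs) ^ 1 : ℝ)⁻¹ * ((1 + ‖latticePoint p.2‖) ^ (2 * n))⁻¹),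
    (continuous_schwartzSup n L).comp continuous_subtype_val, fun p => by positivity,
    (summable_lattice n).mul_left _, fun lam hlam p φ => ?_⟩
  obtain ⟨k, m⟩ := p
  set D : ℝ := 2 ^ k.natAbs
  have hD : 0 < D := by positivity
  set y : ℝ := 1 + ‖latticePoint m‖
  have hy : 0 < y := by positivity
  set F := fInftyNorm q t lam
  have h1 : ‖lam k m‖ ≤ C * D ^ A * y ^ B * F.toReal := by
    have := ENNReal.toReal_mono (ENNReal.mul_ne_top ENNReal.ofReal_ne_top hlam) (h lam k m)
    rwa [toReal_enorm, ENNReal.toReal_mul, ENNReal.toReal_ofReal (by positivity)] at this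
  have hφ : 0 ≤ schwartzSup n L (φ : 𝓢(E n, ℂ)) := apply_nonneg _ _
  calc ‖seriesTerm ψ lam (k, m) φ‖ = ‖lam k m‖ * ‖toSInftyDual (wavelet ψ k m) φ‖ := by
        simp [seriesTerm]
    _ ≤ (C * D ^ A * y ^ B * F.toReal) *
        (C' * (D ^ (A + 1))⁻¹ * (y ^ (B + 2 * n))⁻¹ * schwartzSup n L φ) := by
        gcongr
        exact h' k m φ
    _ = F.toReal * (C * C' * ((D ^ 1)⁻¹ * (y ^ (2 * n))⁻¹)) * schwartzSup n L φ := by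
        rw [pow_add, pow_add]
        field_simp

theorem seriesTerm_sub (ψ : 𝓢(E n, ℂ)) (lam mu : ℤ → (Fin n → ℤ) → ℂ) (p : ℤ × (Fin n → ℤ)) :
    seriesTerm ψ (mu - lam) p = seriesTerm ψ mu p - seriesTerm ψ lam p := by
  ext φ
  simp [seriesTerm, sub_mul]

/-- Summing the domination for the difference of two sequences gives a Lipschitz estimate, uniform
on each bounded set of test functions. The quasi-triangle inequality is not needed, because the
quasi-norm of the difference is small by choice. -/
theorem summable_seriesTerm_and_continuous_Tψ {q : ℝ} {t : ℤ → E n → ℝ} {ψ : 𝓢(E n, ℂ)}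
    {P : Seminorm ℂ (SInfty n)} {w : ℤ × (Fin n → ℤ) → ℝ} (hP : Continuous P)
    (hw0 : ∀ p, 0 ≤ w p) (hw : Summable w)
    (h : ∀ lam : ℤ → (Fin n → ℤ) → ℂ, fInftyNorm q t lam ≠ ∞ → ∀ p φ,
        ‖seriesTerm ψ lam p φ‖ ≤ (fInftyNorm q t lam).toReal * w p * P φ) :
    (∀ lam : FInfty q t, Summable (seriesTerm ψ lam.1)) ∧
      Continuous (Tψ ψ : FInfty q t → SInftyDual n) := by
  have hsum (lam : ℤ → (Fin n → ℤ) → ℂ) (hlam : fInftyNorm q t lam ≠ ∞) :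
      Summable (seriesTerm ψ lam) :=
    summable_of_norm_apply_le_seminorm hP
      (fun p => mul_nonneg ENNReal.toReal_nonneg (hw0 p)) (hw.mul_left _) (h lam hlam)
  refine ⟨fun lam => hsum _ lam.2.ne, continuous_def.2 fun U hU => ?_⟩
  intro lam hlam
  have hN : (fun g => g + Tψ ψ lam) ⁻¹' U ∈ 𝓝 (0 : SInftyDual n) :=
    (continuous_add_const (Tψ ψ lam)).continuousAt.preimage_mem_nhds
      (by simpa using hU.mem_nhds hlam)
  obtain ⟨⟨S, W⟩, ⟨hS, hW⟩, hSW⟩ := ContinuousLinearMap.hasBasis_nhds_zero.mem_iff.1 hN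
  change Bornology.IsVonNBounded ℂ S at hS
  obtain ⟨δ, hδ, hball⟩ := Metric.mem_nhds_iff.1 hW
  obtain ⟨c, hc, hcS⟩ := hS.exists_seminorm_le hP
  have hw1 : 0 ≤ ∑' p, w p := tsum_nonneg hw0
  -- On `S` the difference is at most its quasi-norm times `(∑' p, w p) * c`; the added `1` keeps
  -- the denominator positive.
  refine ⟨ENNReal.ofReal (δ / ((∑' p, w p + 1) * c)), ENNReal.ofReal_pos.2 (by positivity),
    fun mu hmu => ?_⟩
  have hfin : fInftyNorm q t (mu.1 - lam.1) ≠ ∞ := hmu.ne_top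
  have hlt : (fInftyNorm q t (mu.1 - lam.1)).toReal * ((∑' p, w p + 1) * c) < δ := by
    rw [← lt_div_iff₀ (by positivity)]
    exact (ENNReal.lt_ofReal_iff_toReal_lt hfin).1 hmu
  have hdiff : Tψ ψ mu - Tψ ψ lam = ∑' p, seriesTerm ψ (mu.1 - lam.1) p := by
    simp_rw [seriesTerm_sub]
    exact ((hsum _ mu.2.ne).tsum_sub (hsum _ lam.2.ne)).symm
  suffices hmem : Tψ ψ mu - Tψ ψ lam ∈ {f : SInftyDual n | ∀ x ∈ S, f x ∈ W} by
    have := hSW hmem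
    simpa using this
  intro φ hφ
  refine hball (mem_ball_zero_iff.2 ?_)
  have heval : HasSum (fun p => seriesTerm ψ (mu.1 - lam.1) p φ) ((Tψ ψ mu - Tψ ψ lam) φ) := by
    rw [hdiff]
    exact (hsum _ hfin).hasSum.map
      ({ toFun := fun f => f φ, map_zero' := rfl, map_add' := fun _ _ => rfl } :
        SInftyDual n →+ ℂ) (continuous_eval_const φ)
  have hle := tsum_of_norm_bounded ((hw.hasSum.mul_left
    (fInftyNorm q t (mu.1 - lam.1)).toReal).mul_right (P φ)) (h _ hfin · φ)
  rw [heval.tsum_eq] at hle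
  refine hle.trans_lt (lt_of_le_of_lt ?_ hlt)
  rw [mul_assoc]
  gcongr
  · linarith
  · exact hcS φ hφ

end WeightedTL

end

theorem mainTheorem6 (n : ℕ) (α₁ α₂ θ q : ℝ) (hθ : 0 < θ) (hθq : θ ≤ q) (σ₁ σ₂ : ℝ≥0∞)
    (hσ₁ : σ₁ = ENNReal.ofReal θ * ENNReal.conjExponent (ENNReal.ofReal (q / θ)))
    (hσ₂ : ENNReal.ofReal q ≤ σ₂)
    (t : ℤ → WeightedTL.E n → ℝ)
    (ht : WeightedTL.InClassX α₁ α₂ σ₁ σ₂ (ENNReal.ofReal q) t)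
    (ψ : 𝓢(WeightedTL.E n, ℂ))
    (hψ_supp : tsupport (WeightedTL.fourier ψ) ⊆ {ξ | 1 / 2 ≤ ‖ξ‖ ∧ ‖ξ‖ ≤ 2})
    (hψ_lower : ∃ c : ℝ, 0 < c ∧ ∀ ξ : WeightedTL.E n, 3 / 5 ≤ ‖ξ‖ → ‖ξ‖ ≤ 5 / 3 →
      c ≤ ‖WeightedTL.fourier ψ ξ‖) :
    (∀ lam : WeightedTL.FInfty q t, Summable (WeightedTL.seriesTerm ψ lam.1)) ∧
      Continuous (WeightedTL.Tψ ψ : WeightedTL.FInfty q t → WeightedTL.SInftyDual n) := by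
  obtain ⟨P, w, hP, hw0, hw, h⟩ := WeightedTL.exists_norm_seriesTerm_le (hθ.trans_le hθq) ht
    (ENNReal.ofReal_pos.2 hθ).ne' (hσ₁ ▸ WeightedTL.holderTriple_mul_conjExponent hθ hθq) hσ₂
    (WeightedTL.mem_SInfty_of_tsupport_fourier hψ_supp)
  exact WeightedTL.summable_seriesTerm_and_continuous_Tψ hP hw0 hw h
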